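/- **Setting.** Data sources $1,\dots,K$ produce observations $X^k_n$, $n\in\mathbb N=\{1,2,\dots\}$. For $s\subseteq[K]$ let $\mathcal F_n^s=\sigma(X^k_m: k\in s,\,m\le n)$, $\mathcal F_n=\mathcal F_n^{[K]}$, and for a distribution $\mathsf P$ of $X$ let $\mathsf P^s$ be the marginal distribution of $X^s=(X^k_n)_{k\in s,\,n\ge1}$. Let $\mathcal P$ be a finite family of distributions of $X$, $\mathcal K$ a finite family of subsets of $[K]$ (units), and for $e\in\mathcal K$ let $\mathcal H^e,\mathcal G^e$ be non-empty disjoint subfamilies of $\mathcal P^e=\{\mathsf P^e:\mathsf P\in\mathcal P\}$. Let $\mathcal A(\mathsf P)=\{e\in\mathcal K:\mathsf P^e\in\mathcal G^e\}$. Let $\Psi$ be a family of subsets of $\mathcal K$, and for such a family put $\mathcal P_\Psi=\{\mathsf P\in\mathcal P:\mathsf P^e\in\mathcal H^e\cup\mathcal G^e\ \forall e\in\mathcal K,\ \mathcal A(\mathsf P)\in\Psi\}$; $\mathcal H_0=\mathcal P_{\{\emptyset\}}$, $\mathcal H_{\Psi,e}=\{\mathsf P\in\mathcal P_\Psi\setminus\mathcal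 H_0:e\notin\mathcal A(\mathsf P)\}$, $\mathcal G_{\Psi,e}=\{\mathsf P\in\mathcal P_\Psi:e\in\mathcal A(\mathsf P)\}$. **Assumptions.** For all $e\in\mathcal K$, $\mathsf P\in\mathcal G_{\Psi,e}\cup\mathcal H_0$, $\mathsf Q\in\mathcal H_{\Psi,e}\cup\mathcal H_0$, $e\subseteq s\subseteq[K]$, $n\in\mathbb N$, the measures $\mathsf P$ and $\mathsf Q$ are mutually absolutely continuous on $\mathcal F_n^s$. Write $\Lambda_n(\mathsf P^s,\mathsf Q^s)$ for the likelihood ratio on $\mathcal F^s_n$ and $Z_n=\log\Lambda_n$. For all $e\in\mathcal K$, $\mathsf P\in\mathcal G_{\Psi,e}$, $\mathsf Q\in\mathcal H_{\Psi,e}\cup\mathcal H_0$, $e\subseteq s\subseteq[K]$, and for $(\mathsf R,\mathsf S)=(\mathsf P,\mathsf Q)$ as well as $(\mathsf R,\mathsf S)=(\mathsf Q,\mathsf P)$, there is a (necessarily unique) number $\mathcal I(\mathsf R,\mathsf S;s)>0$ such that $$\mathsf R\Big(\max_{1\le m\le n}Z_m(\mathsf R^s,\mathsf S^s)\ge n\rho\Big)\to0\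 \ \forall\rho>\mathcal I(\mathsf R,\mathsf S;s),\qquad \sum_{n\ge1}\mathsf R\big(Z_n(\mathsf R^s,\mathsf S^s)<n\rho\big)<\infty\ \ \forall\rho<\mathcal I(\mathsf R,\mathsf S;s).$$ Put $\mathcal I(\mathsf P,\mathcal Q;s)=\inf_{\mathsf Q\in\mathcal Q}\mathcal I(\mathsf P,\mathsf Q;s)$ ($=\infty$ if $\mathcal Q=\emptyset$), and omit $s$ when $s=[K]$. **Classes of tests.** A test is a pair $(T,D)$ with $T$ an $\{\mathcal F_n\}$-stopping time with values in $\mathbb N\cup\{\infty\}$ and $D$ an $\mathcal F_T$-measurable $\Psi$-valued decision, made when $T<\infty$; the error events below concern $\{T<\infty\}$. For levels in $(0,1)$: * $\mathcal D_\Psi(\alpha,\beta)$: tests with $\mathsf P(D\ne\emptyset)\le\alpha$ for $\mathsf P\in\mathcal H_0$ and $\mathsf P(D=\emptyset)\le\beta$ for $\mathsf P\in\mathcal P_\Psi\setminus\mathcal H_0$. * $\mathcal C_\Psi(\alpha,\beta,\gamma,\delta)$: tests in $\mathcal D_\Psi(\alpha,\beta)$ with, in addition, $\mathsf P(D\setminus\mathcal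 A(\mathsf P)\ne\emptyset)\le\gamma$ and $\mathsf P(\mathcal A(\mathsf P)\setminus D\neq\emptyset,\,D\ne\emptyset)\le\delta$ for $\mathsf P\in\mathcal P_\Psi\setminus\mathcal H_0$. * $\mathcal E_\Psi(\gamma,\delta)$: tests with $\mathsf P(D\setminus\mathcal A(\mathsf P)\ne\emptyset)\le\gamma$ and $\mathsf P(\mathcal A(\mathsf P)\setminus D\ne\emptyset)\le\delta$ for $\mathsf P\in\mathcal P_\Psi$. **Proposed tests.** For each unit $e$ choose $s_e,s'_e\subseteq[K]$, both containing $e$, and let $$\Lambda_{e,\rm det}(n)=\frac{\max_{\mathsf P\in\mathcal G_{\Psi,e}}\Lambda_n(\mathsf P^{s_e},\mathsf P_0^{s_e})}{\max_{\mathsf P\in\mathcal H_0}\Lambda_n(\mathsf P^{s_e},\mathsf P_0^{s_e})},\qquad \Lambda_{e,\rm iso}(n)=\frac{\max_{\mathsf P\in\mathcal G_{\Psi,e}}\Lambda_n(\mathsf P^{s'_e},\mathsf P_0'^{\,s'_e})}{\max_{\mathsf P\in\mathcal H_{\Psi,e}}\Lambda_n(\mathsf P^{s'_e},\mathsf P_0'^{\,s'_e})}$$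 with arbitrary $\mathsf P_0,\mathsf P_0'\in\mathcal H_0$, possibly depending on $e$ (maxima over the empty set are $0$; $0/0=0$ and $x/0=\infty$ for $x>0$), $D_{\rm iso}(n)=\{e\in\mathcal K:\Lambda_{e,\rm iso}(n)>1\}$. Given positive thresholds $A_e,B_e,C_e,D_e$, let * $T_0=\inf\{n\ge1:\Lambda_{e,\rm det}(n)\le1/C_e\ \forall e\}$, $T_{det}=\inf\{n\ge1:\Lambda_{e,\rm det}(n)\ge D_e\text{ for some }e\}$, * $T_{joint}=\inf\{n\ge1:\Lambda_{e,\rm det}(n)\ge D_e\text{ for some }e,\ \Lambda_{e,\rm iso}(n)\notin(1/A_e,B_e)\ \forall e,\ D_{\rm iso}(n)\in\Psi\setminus\{\emptyset\}\}$; * $\chi^*_{det}$: $T^*_{det}=\min\{T_0,T_{det}\}$, with any decision $D^*_{det}$ that, on stopping, is empty exactly when $T_0<T_{det}$; * $\chi^*$: $T^*=\min\{T_0,T_{joint}\}$, $D^*=\emptyset$ if $T_0<T_{joint}$ and $D^*=D_{\rm iso}(T^*)$ otherwise; * $\chi^*_{fwer}=(T^*_{fwer},D^*_{fwer})$: the test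 $\chi^*$ with $C_e=A_e$, $D_e=B_e$ for all $e$. The thresholds of $\chi^*_{det}$, $\chi^*$, $\chi^*_{fwer}$ are functions of $(\alpha,\beta)$, of $(\alpha,\beta,\gamma,\delta)$ and of $(\gamma,\delta)$, respectively, such that $\chi^*_{det}\in\mathcal D_\Psi(\alpha,\beta)$, $\chi^*\in\mathcal C_\Psi(\alpha,\beta,\gamma,\delta)$, $\chi^*_{fwer}\in\mathcal E_\Psi(\gamma,\delta)$ for all levels in $(0,1)$ and, in the limit regime considered, for every $e\in\mathcal K$: $\log C_e\sim|\log\beta|$ for $\chi^*_{det}$ and $\chi^*$, and $\log A_e\sim|\log\delta|$ for $\chi^*_{fwer}$. **Theorem.** Let $\emptyset\in\Psi$, let $\mathsf P\in\mathcal H_0$, let $\mathcal G_{\Psi,e}\ne\emptyset$ for at least one $e\in\mathcal K$, and let the detection subsystems satisfy $$\min_{e\in\mathcal K}\mathcal I(\mathsf P,\mathcal G_{\Psi,e};s_e)=\min_{e\in\mathcal K}\mathcal I(\mathsf P,\mathcal G_{\Psi,e}),$$ which is the case when $s_e=[K]$ for every $e\in\mathcal K$. Then, as $\alpha,\beta\to0$,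 $$\mathsf E_{\mathsf P}[T^*_{det}]\sim\max_{e\in\mathcal K}\frac{|\log\beta|}{\mathcal I(\mathsf P,\mathcal G_{\Psi,e})}\sim\inf\{\mathsf E_{\mathsf P}[T]:(T,D)\in\mathcal D_\Psi(\alpha,\beta)\};$$ as $\alpha,\beta\to0$, while each of $\gamma$ and $\delta$ is either fixed in $(0,1)$ or goes to $0$, $$\mathsf E_{\mathsf P}[T^*]\sim\max_{e\in\mathcal K}\frac{|\log\beta|}{\mathcal I(\mathsf P,\mathcal G_{\Psi,e})}\sim\inf\{\mathsf E_{\mathsf P}[T]:(T,D)\in\mathcal C_\Psi(\alpha,\beta,\gamma,\delta)\};$$ and as $\gamma,\delta\to0$, $$\mathsf E_{\mathsf P}[T^*_{fwer}]\sim\max_{e\in\mathcal K}\frac{|\log\delta|}{\mathcal I(\mathsf P,\mathcal G_{\Psi,e})}\sim\inf\{\mathsf E_{\mathsf P}[T]:(T,D)\in\mathcal E_\Psi(\gamma,\delta)\}.$$ -/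

import Mathlib

open MeasureTheory Filter Topology
open scoped ENNReal

/-- Trajectories of the data sources in `s`: `ω m k` is the observation of source `k` at time
`m + 1` (times are `1, 2, …`). -/
abbrev SubTraj {K : ℕ} (E : Fin K → Type*) (s : Finset (Fin K)) := ℕ → (k : s) → E k

/-- Trajectories of all `K` data sources: `ω m k` is the observation of source `k` at time
`m + 1`. -/
abbrev Traj {K : ℕ} (E : Fin K → Type*) := ℕ → (k : Fin K) → E k

section Paths

variable {K : ℕ} {E : Fin K → Type*} [∀ k, MeasurableSpace (E k)]

/-- The σ-field generated by the observations of the sources in `s` up to time `n`. -/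
abbrev obsField (E : Fin K → Type*) [∀ k, MeasurableSpace (E k)] (s : Finset (Fin K)) (n : ℕ) :
    MeasurableSpace (Traj E) :=
  ⨆ k ∈ s, ⨆ m ∈ Finset.range n, MeasurableSpace.comap (fun ω : Traj E => ω m k) inferInstance

theorem obsField_le (s : Finset (Fin K)) (n : ℕ) :
    obsField E s n ≤ (inferInstance : MeasurableSpace (Traj E)) := by
  refine iSup₂_le fun k _ => iSup₂_le fun m _ => ?_
  exact Measurable.comap_le (by fun_prop)

/-- The marginal distribution `P^s` of the sources in `s`. -/
noncomputable def marginal (s : Finset (Fin K)) (P : Measure (Traj E)) :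
    Measure (SubTraj E s) :=
  P.map fun ω m k => ω m k

/-- The restriction of `P` to the σ-field of the sources in `s` up to time `n`. -/
noncomputable def restr (s : Finset (Fin K)) (n : ℕ) (P : Measure (Traj E)) :
    @Measure (Traj E) (obsField E s n) :=
  P.trim (obsField_le s n)

/-- The likelihood ratio `Λ_n(P^s, Q^s)`. -/
noncomputable def likRatio (s : Finset (Fin K)) (n : ℕ) (P Q : Measure (Traj E))
    (ω : Traj E) : ℝ≥0∞ :=
  @Measure.rnDeriv _ (obsField E s n) (restr s n P) (restr s n Q) ω

/-- The log-likelihood ratio `Z_n(P^s, Q^s)`. -/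
noncomputable def logLik (s : Finset (Fin K)) (n : ℕ) (P Q : Measure (Traj E))
    (ω : Traj E) : ℝ :=
  Real.log (likRatio s n P Q ω).toReal

/-- `r` is a (positive) information number of `P` against `Q` based on the sources in `s`:
`P(max_{1 ≤ m ≤ n} Z_m ≥ n ρ) → 0` for all `ρ > r`, and
`∑_{n ≥ 1} P(Z_n < n ρ) < ∞` for all `ρ < r`, where `Z_n = Z_n(P^s, Q^s)`. -/
structure IsInfo (s : Finset (Fin K)) (P Q : Measure (Traj E)) (r : ℝ) : Prop where
  pos : 0 < r
  upper : ∀ ρ : ℝ, r < ρ →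
    Tendsto (fun n : ℕ => P {ω | ∃ m ∈ Finset.Icc 1 n, (n : ℝ) * ρ ≤ logLik s m P Q ω})
      atTop (𝓝 0)
  lower : ∀ ρ : ℝ, ρ < r →
    ∑' n : ℕ, P {ω | logLik s (n + 1) P Q ω < ((n + 1 : ℕ) : ℝ) * ρ} < ∞

/-- An information number is unique, so the choice made in `info` is immaterial. -/
theorem IsInfo.unique {s : Finset (Fin K)} {P Q : Measure (Traj E)} [IsProbabilityMeasure P]
    {r t : ℝ} (hr : IsInfo s P Q r) (ht : IsInfo s P Q t) : r = t := by
  have key : ∀ {a b : ℝ}, IsInfo s P Q a → IsInfo s P Q b → ¬ a < b := by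
    intro a b ha hb hab
    obtain ⟨ρ, h1, h2⟩ := exists_between hab
    have u := (ha.upper ρ h1).comp (tendsto_add_atTop_nat 1)
    have l := ENNReal.tendsto_atTop_zero_of_tsum_ne_top (hb.lower ρ h2).ne
    have h := u.add l
    rw [add_zero] at h
    have : ∀ n : ℕ, (1 : ℝ≥0∞) ≤
        P {ω | ∃ m ∈ Finset.Icc 1 (n + 1), ((n + 1 : ℕ) : ℝ) * ρ ≤ logLik s m P Q ω} +
        P {ω | logLik s (n + 1) P Q ω < ((n + 1 : ℕ) : ℝ) * ρ} := by
      intro n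
      rw [← measure_univ (μ := P)]
      refine (measure_mono ?_).trans (measure_union_le _ _)
      intro ω _
      by_cases hω : logLik s (n + 1) P Q ω < ((n + 1 : ℕ) : ℝ) * ρ
      · exact Or.inr hω
      · exact Or.inl ⟨n + 1, by simp, not_lt.mp hω⟩
    exact absurd (ge_of_tendsto' h this) (by simp)
  exact le_antisymm (not_lt.mp (key ht hr)) (not_lt.mp (key hr ht))

open Classical in
/-- The information number `I(P, Q; s)` (`0` if there is none). -/
noncomputable def info (s : Finset (Fin K)) (P Q : Measure (Traj E)) : ℝ :=
  if h : ∃ r, IsInfo s P Q r then h.choose else 0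

/-- `I(P, 𝒬; s) = inf_{Q ∈ 𝒬} I(P, Q; s)`, equal to `∞` when `𝒬` is empty. -/
noncomputable def infoSet (s : Finset (Fin K)) (P : Measure (Traj E))
    (𝒬 : Set (Measure (Traj E))) : ℝ≥0∞ :=
  ⨅ Q ∈ 𝒬, ENNReal.ofReal (info s P Q)

/-- `E_P[T]`. -/
noncomputable def expectedTime (P : Measure (Traj E)) (T : Traj E → ℕ∞) : ℝ≥0∞ :=
  ∫⁻ ω, (T ω : ℝ≥0∞) ∂P

/-- The smallest expected sample size under `P` over a class of tests. -/
noncomputable def optTime (P : Measure (Traj E))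
    (C : (Traj E → ℕ∞) → (Traj E → Finset (Finset (Fin K))) → Prop) : ℝ≥0∞ :=
  ⨅ (T : Traj E → ℕ∞) (D : Traj E → Finset (Finset (Fin K))) (_ : C T D), expectedTime P T

end Paths

/-- The first time `n ∈ {1, 2, …}` with `p n` (`∞` if there is none). -/
noncomputable def firstTime (p : ℕ → Prop) : ℕ∞ :=
  ⨅ n : ℕ, ⨅ _ : 1 ≤ n ∧ p n, (n : ℕ∞)

/-- `f ∼ g` along `l`: the ratio `f / g` tends to `1`. -/
def AsympEq {X : Type*} (l : Filter X) (f g : X → ℝ≥0∞) : Prop :=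
  Tendsto (fun x => f x / g x) l (𝓝 1)

/-- A regime for an error level: it goes to `0` or it is fixed in `(0, 1)`. -/
def IsRegime (l : Filter ℝ) : Prop :=
  l = 𝓝[>] 0 ∨ ∃ c ∈ Set.Ioo (0 : ℝ) 1, l = pure c

/-- A multiple testing problem: a finite family of global distributions, units, a null and an
alternative family of marginal distributions for each unit, and a family of possible signal
sets. -/
structure Model {K : ℕ} (E : Fin K → Type*) [∀ k, MeasurableSpace (E k)] where
  /-- the plausible global distributions -/
  dists : Set (Measure (Traj E))
  dists_finite : dists.Finite
  dists_prob : ∀ P ∈ dists, IsProbabilityMeasure P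
  /-- the units -/
  units : Finset (Finset (Fin K))
  /-- the null family of a unit -/
  nullHyp : (e : Finset (Fin K)) → Set (Measure (SubTraj E e))
  /-- the alternative family of a unit -/
  altHyp : (e : Finset (Fin K)) → Set (Measure (SubTraj E e))
  nullHyp_nonempty : ∀ e ∈ units, (nullHyp e).Nonempty
  altHyp_nonempty : ∀ e ∈ units, (altHyp e).Nonempty
  nullHyp_subset : ∀ e ∈ units, nullHyp e ⊆ marginal e '' dists
  altHyp_subset : ∀ e ∈ units, altHyp e ⊆ marginal e '' dists
  hyp_disjoint : ∀ e ∈ units, Disjoint (nullHyp e) (altHyp e)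
  /-- the family `Ψ` of possible signal sets -/
  configs : Set (Finset (Finset (Fin K)))
  configs_subset : ∀ A ∈ configs, A ⊆ units

namespace Model

variable {K : ℕ} {E : Fin K → Type*} [∀ k, MeasurableSpace (E k)] (M : Model E)

open Classical in
/-- The signal set `𝒜(P)`. -/
noncomputable def signals (P : Measure (Traj E)) : Finset (Finset (Fin K)) :=
  M.units.filter fun e => marginal e P ∈ M.altHyp e

/-- The global distributions compatible with a family `Φ` of signal sets. -/
def compatible (Φ : Set (Finset (Finset (Fin K)))) : Set (Measure (Traj E)) :=
  {P | P ∈ M.dists ∧ (∀ e ∈ M.units, marginal e P ∈ M.nullHyp e ∪ M.altHyp e) ∧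
    M.signals P ∈ Φ}

/-- `𝒫_Ψ`. -/
def plausible : Set (Measure (Traj E)) := M.compatible M.configs

/-- The global null distributions `ℋ_0`. -/
def globalNull : Set (Measure (Traj E)) := M.compatible {∅}

/-- `ℋ_{Ψ,e}`: the non-null distributions under which `e` is not a signal. -/
def nullAt (e : Finset (Fin K)) : Set (Measure (Traj E)) :=
  {P | P ∈ M.plausible \ M.globalNull ∧ e ∉ M.signals P}

/-- `𝒢_{Ψ,e}`: the distributions under which `e` is a signal. -/
def altAt (e : Finset (Fin K)) : Set (Measure (Traj E)) :=
  {P | P ∈ M.plausible ∧ e ∈ M.signals P}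

/-- Mutual absolute continuity at all finite times. -/
def MutuallyAC : Prop :=
  ∀ e ∈ M.units, ∀ P ∈ M.altAt e ∪ M.globalNull, ∀ Q ∈ M.nullAt e ∪ M.globalNull,
    ∀ s : Finset (Fin K), e ⊆ s → ∀ n : ℕ, 1 ≤ n →
      @Measure.AbsolutelyContinuous _ (obsField E s n) (restr s n P) (restr s n Q) ∧
      @Measure.AbsolutelyContinuous _ (obsField E s n) (restr s n Q) (restr s n P)

/-- The distributional assumption: positive information numbers exist. -/
def HasInfo : Prop :=
  ∀ e ∈ M.units, ∀ P ∈ M.altAt e, ∀ Q ∈ M.nullAt e ∪ M.globalNull,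
    ∀ s : Finset (Fin K), e ⊆ s → (∃ r, IsInfo s P Q r) ∧ ∃ r, IsInfo s Q P r

/-- `(T, D)` is a test: `T` is a stopping time with values in `{1, 2, …, ∞}`, and the decision
`D`, made when `T < ∞`, is `ℱ_T`-measurable and `Ψ`-valued. -/
structure IsTest (T : Traj E → ℕ∞) (D : Traj E → Finset (Finset (Fin K))) : Prop where
  one_le : ∀ ω, 1 ≤ T ω
  stopping : ∀ n : ℕ, 1 ≤ n → MeasurableSet[obsField E Finset.univ n] {ω | T ω = n}
  decision : ∀ n : ℕ, 1 ≤ n → ∀ A ∈ M.configs,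
    MeasurableSet[obsField E Finset.univ n] {ω | T ω = n ∧ D ω = A}
  valued : ∀ ω, T ω ≠ ⊤ → D ω ∈ M.configs

/-- The class `𝒟_Ψ(α, β)` (pure detection). -/
structure DetClass (α β : ℝ) (T : Traj E → ℕ∞) (D : Traj E → Finset (Finset (Fin K))) :
    Prop where
  test : M.IsTest T D
  false_alarm : ∀ P ∈ M.globalNull, P {ω | T ω ≠ ⊤ ∧ D ω ≠ ∅} ≤ ENNReal.ofReal α
  missed_detection : ∀ P ∈ M.plausible \ M.globalNull,
    P {ω | T ω ≠ ⊤ ∧ D ω = ∅} ≤ ENNReal.ofReal β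

/-- The class `𝒞_Ψ(α, β, γ, δ)` (joint detection and isolation). -/
structure JointClass (α β γ δ : ℝ) (T : Traj E → ℕ∞)
    (D : Traj E → Finset (Finset (Fin K))) : Prop where
  det : M.DetClass α β T D
  false_positive : ∀ P ∈ M.plausible \ M.globalNull,
    P {ω | T ω ≠ ⊤ ∧ D ω \ M.signals P ≠ ∅} ≤ ENNReal.ofReal γ
  false_negative : ∀ P ∈ M.plausible \ M.globalNull,
    P {ω | T ω ≠ ⊤ ∧ M.signals P \ D ω ≠ ∅ ∧ D ω ≠ ∅} ≤ ENNReal.ofReal δ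

/-- The class `ℰ_Ψ(γ, δ)` (familywise error control). -/
structure FwerClass (γ δ : ℝ) (T : Traj E → ℕ∞) (D : Traj E → Finset (Finset (Fin K))) :
    Prop where
  test : M.IsTest T D
  false_positive : ∀ P ∈ M.plausible,
    P {ω | T ω ≠ ⊤ ∧ D ω \ M.signals P ≠ ∅} ≤ ENNReal.ofReal γ
  false_negative : ∀ P ∈ M.plausible,
    P {ω | T ω ≠ ⊤ ∧ M.signals P \ D ω ≠ ∅} ≤ ENNReal.ofReal δ

/-- `max_{e} |log x| / I(P, 𝒢_{Ψ,e})`. -/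
noncomputable def rate (P : Measure (Traj E)) (x : ℝ) : ℝ≥0∞ :=
  ⨆ e ∈ M.units, (ENNReal.ofReal |Real.log x| / infoSet Finset.univ P (M.altAt e))

end Model

/-- Detection and isolation subsystems of the units, and the reference distributions
used to write down the statistics. -/
structure Design {K : ℕ} {E : Fin K → Type*} [∀ k, MeasurableSpace (E k)] (M : Model E) where
  /-- the detection subsystem of a unit -/
  detSub : Finset (Fin K) → Finset (Fin K)
  /-- the isolation subsystem of a unit -/
  isoSub : Finset (Fin K) → Finset (Fin K)
  subset_detSub : ∀ e ∈ M.units, e ⊆ detSub e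
  subset_isoSub : ∀ e ∈ M.units, e ⊆ isoSub e
  /-- the reference distribution of the detection statistic -/
  detRef : Finset (Fin K) → Measure (Traj E)
  /-- the reference distribution of the isolation statistic -/
  isoRef : Finset (Fin K) → Measure (Traj E)
  detRef_mem : ∀ e ∈ M.units, detRef e ∈ M.globalNull
  isoRef_mem : ∀ e ∈ M.units, isoRef e ∈ M.globalNull

/-- Thresholds `A_e, B_e, C_e, D_e`. -/
structure Thresholds (K : ℕ) where
  A : Finset (Fin K) → ℝ
  B : Finset (Fin K) → ℝ
  C : Finset (Fin K) → ℝ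
  D : Finset (Fin K) → ℝ

namespace Design

variable {K : ℕ} {E : Fin K → Type*} [∀ k, MeasurableSpace (E k)] {M : Model E} (S : Design M)

/-- The detection statistic `Λ_{e,det}(n)`. -/
noncomputable def detStat (e : Finset (Fin K)) (n : ℕ) (ω : Traj E) : ℝ≥0∞ :=
  (⨆ P ∈ M.altAt e, likRatio (S.detSub e) n P (S.detRef e) ω) /
    (⨆ P ∈ M.globalNull, likRatio (S.detSub e) n P (S.detRef e) ω)

/-- The isolation statistic `Λ_{e,iso}(n)`. -/
noncomputable def isoStat (e : Finset (Fin K)) (n : ℕ) (ω : Traj E) : ℝ≥0∞ :=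
  (⨆ P ∈ M.altAt e, likRatio (S.isoSub e) n P (S.isoRef e) ω) /
    (⨆ P ∈ M.nullAt e, likRatio (S.isoSub e) n P (S.isoRef e) ω)

open Classical in
/-- `D_iso(n)`: the units whose isolation statistic exceeds `1`. -/
noncomputable def isoSet (n : ℕ) (ω : Traj E) : Finset (Finset (Fin K)) :=
  M.units.filter fun e => 1 < S.isoStat e n ω

/-- `T_0`. -/
noncomputable def timeNull (C : Finset (Fin K) → ℝ) (ω : Traj E) : ℕ∞ :=
  firstTime fun n => ∀ e ∈ M.units, S.detStat e n ω ≤ ENNReal.ofReal (1 / C e)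

/-- `T_det`. -/
noncomputable def timeDet (D : Finset (Fin K) → ℝ) (ω : Traj E) : ℕ∞ :=
  firstTime fun n => ∃ e ∈ M.units, ENNReal.ofReal (D e) ≤ S.detStat e n ω

/-- `T_joint`. -/
noncomputable def timeJoint (τ : Thresholds K) (ω : Traj E) : ℕ∞ :=
  firstTime fun n =>
    (∃ e ∈ M.units, ENNReal.ofReal (τ.D e) ≤ S.detStat e n ω) ∧
    (∀ e ∈ M.units, S.isoStat e n ω ∉
      Set.Ioo (ENNReal.ofReal (1 / τ.A e)) (ENNReal.ofReal (τ.B e))) ∧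
    S.isoSet n ω ∈ M.configs \ {∅}

/-- The stopping time `T*_det = min{T_0, T_det}` of the detection test. -/
noncomputable def detTime (C D : Finset (Fin K) → ℝ) (ω : Traj E) : ℕ∞ :=
  min (S.timeNull C ω) (S.timeDet D ω)

/-- `Δ` is a decision of the detection test: on stopping, it is empty exactly when
`T_0 < T_det`. (Which non-empty set is selected otherwise is left open.) -/
def IsDetDecision (C D : Finset (Fin K) → ℝ) (Δ : Traj E → Finset (Finset (Fin K))) : Prop :=
  ∀ ω, S.detTime C D ω ≠ ⊤ → (Δ ω = ∅ ↔ S.timeNull C ω < S.timeDet D ω)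

/-- The stopping time `T* = min{T_0, T_joint}` of the joint test. -/
noncomputable def jointTime (τ : Thresholds K) (ω : Traj E) : ℕ∞ :=
  min (S.timeNull τ.C ω) (S.timeJoint τ ω)

open Classical in
/-- The decision `D*` of the joint test. -/
noncomputable def jointDecision (τ : Thresholds K) (ω : Traj E) : Finset (Finset (Fin K)) :=
  if S.timeNull τ.C ω < S.timeJoint τ ω then ∅ else S.isoSet (S.jointTime τ ω).toNat ω

/-- The detection subsystems are large enough for `P`:
`min_e I(P, 𝒢_{Ψ,e}; s_e) = min_e I(P, 𝒢_{Ψ,e})`. -/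
def DetSubLarge (P : Measure (Traj E)) : Prop :=
  (⨅ e ∈ M.units, infoSet (S.detSub e) P (M.altAt e)) =
    (⨅ e ∈ M.units, infoSet Finset.univ P (M.altAt e))

end Design

/-! Only detection matters under the global null. Let r be the least information number I(P, G) over
all alternatives G of all units, attained since these are finitely many, and let b be the
missed-detection level. Lower bound: a test that stops by time n either raises a false alarm, or
sees the log-likelihood ratio of P against the minimizing G cross a level y, or declares the null
while this ratio is below y. A change of measure bounds the last probability by exp(y) times the
missed-detection probability under G. With n slightly below |log b| / r and y just under |log b|,
all three are small, so E[T] is at least about n (`mul_one_sub_le_expectedTime`,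
`eventually_le_expectedTime`). Upper bound: each procedure stops no later than T_0. The denominator
of a detection statistic dominates the likelihood of P itself, so T_0 has occurred once every
log-likelihood ratio of P against an alternative exceeds its log-threshold. Below slope ρ < r these
ratios lie only summably often, so E[T_0] is at most |log b| / ρ up to a factor near 1 and a
constant (`expectedTime_timeNull_le`). The assumption on detection subsystems makes r the relevant
rate here too. Joint and familywise classes lie inside detection classes, so one sandwich
(`asympEq_expectedTime_optTime`) gives all three claims. -/

/-- The wait beyond `N` is at most the number of later times at which `p` fails, which is infinite
if `p` never holds again. In expectation this count becomes a sum of probabilities. -/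
theorem coe_firstTime_le_add_tsum (p : ℕ → Prop) [DecidablePred p] {N : ℕ} (hN : 1 ≤ N) :
    ((firstTime p : ℕ∞) : ℝ≥0∞) ≤ N + ∑' n, (if p (N + n) then 0 else 1 : ℝ≥0∞) := by
  by_cases h : ∃ k, p (N + k)
  · have h1 : firstTime p ≤ ((N + Nat.find h : ℕ) : ℕ∞) :=
      iInf₂_le (N + Nat.find h) ⟨by omega, Nat.find_spec h⟩
    have h2 : ((firstTime p : ℕ∞) : ℝ≥0∞) ≤ (((N + Nat.find h : ℕ) : ℕ∞) : ℝ≥0∞) :=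
      ENat.toENNReal_le.mpr h1
    have h3 : ∑ n ∈ Finset.range (Nat.find h), (if p (N + n) then 0 else 1 : ℝ≥0∞)
        = Nat.find h := by
      rw [Finset.sum_congr rfl (g := fun _ => (1 : ℝ≥0∞))]
      · simp
      · intro n hn
        rw [if_neg (Nat.find_min h (Finset.mem_range.mp hn))]
    refine h2.trans ?_
    rw [ENat.toENNReal_coe]
    push_cast
    gcongr
    rw [← h3]
    exact ENNReal.sum_le_tsum _
  · push Not at h
    simp [h]

/-! ### Change of measure and the chain rule for densities -/

section AbstractLikelihood

variable {Ω : Type*} [MeasurableSpace Ω]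

theorem measure_inter_log_rnDeriv_lt_le {μ ν : Measure Ω} [IsFiniteMeasure μ] [IsFiniteMeasure ν]
    (h : μ ≪ ν) (A : Set Ω) (y : ℝ) :
    μ (A ∩ {ω | Real.log (μ.rnDeriv ν ω).toReal < y}) ≤ ENNReal.ofReal (Real.exp y) * ν A := by
  set B := {ω | Real.log (μ.rnDeriv ν ω).toReal < y}
  rw [← Measure.setLIntegral_rnDeriv h (A ∩ B)]
  calc ∫⁻ ω in A ∩ B, μ.rnDeriv ν ω ∂ν
      ≤ ∫⁻ _ in A ∩ B, ENNReal.ofReal (Real.exp y) ∂ν := by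
        refine setLIntegral_mono_ae measurable_const.aemeasurable ?_
        filter_upwards [Measure.rnDeriv_lt_top μ ν] with ω hω hω'
        rw [← ENNReal.ofReal_toReal hω.ne]
        refine ENNReal.ofReal_le_ofReal ?_
        -- Since `Real.log 0 = 0`, a vanishing density need not satisfy the log inequality usefully,
        -- but there the bound is trivial.
        rcases ENNReal.toReal_nonneg.eq_or_lt' with h0 | h0
        · rw [h0]; positivity
        · exact ((Real.log_lt_iff_lt_exp h0).mp hω'.2).le
    _ = ENNReal.ofReal (Real.exp y) * ν (A ∩ B) := by simp
    _ ≤ ENNReal.ofReal (Real.exp y) * ν A := by gcongr; exact Set.inter_subset_left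

/-- The reference measure cancels by the chain rule, which is why its choice in the detection
statistics is immaterial. -/
theorem rnDeriv_div_rnDeriv_ae_eq {μ ν κ : Measure Ω} [IsFiniteMeasure μ] [IsFiniteMeasure ν]
    [IsFiniteMeasure κ] (hνμ : ν ≪ μ) (hμν : μ ≪ ν) (hμκ : μ ≪ κ) :
    ∀ᵐ ω ∂μ, ν.rnDeriv κ ω / μ.rnDeriv κ ω = (μ.rnDeriv ν ω)⁻¹ := by
  filter_upwards [hμκ.ae_le (Measure.rnDeriv_mul_rnDeriv (κ := κ) hνμ),
    Measure.inv_rnDeriv hμν, Measure.rnDeriv_pos hμκ,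
    hμκ.ae_le (Measure.rnDeriv_lt_top μ κ)] with ω h1 h2 h3 h4
  rw [← h1, Pi.mul_apply, ENNReal.mul_div_cancel_right h3.ne' h4.ne, ← h2, Pi.inv_apply]

end AbstractLikelihood

/-! ### Likelihood ratios on the observation σ-fields -/

section Paths

variable {K : ℕ} {E : Fin K → Type*} [∀ k, MeasurableSpace (E k)]

instance isFiniteMeasure_restr (s : Finset (Fin K)) (n : ℕ) (P : Measure (Traj E))
    [IsFiniteMeasure P] : @IsFiniteMeasure _ (obsField E s n) (restr s n P) :=
  isFiniteMeasure_trim _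

theorem measurable_likRatio_obsField (s : Finset (Fin K)) (n : ℕ) (P Q : Measure (Traj E)) :
    @Measurable _ _ (obsField E s n) _ (likRatio s n P Q) :=
  @Measure.measurable_rnDeriv _ (obsField E s n) _ _

theorem measurable_logLik_obsField (s : Finset (Fin K)) (n : ℕ) (P Q : Measure (Traj E)) :
    @Measurable _ _ (obsField E s n) _ (logLik s n P Q) :=
  Real.measurable_log.comp
    (ENNReal.measurable_toReal.comp (measurable_likRatio_obsField s n P Q))

theorem measurable_logLik (s : Finset (Fin K)) (n : ℕ) (P Q : Measure (Traj E)) :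
    Measurable (logLik s n P Q) :=
  (measurable_logLik_obsField s n P Q).mono (obsField_le s n) le_rfl

theorem measure_inter_logLik_lt_le {s : Finset (Fin K)} {n : ℕ} {P Q : Measure (Traj E)}
    [IsFiniteMeasure P] [IsFiniteMeasure Q]
    (h : @Measure.AbsolutelyContinuous _ (obsField E s n) (restr s n P) (restr s n Q))
    {A : Set (Traj E)} (hA : MeasurableSet[obsField E s n] A) (y : ℝ) :
    P (A ∩ {ω | logLik s n P Q ω < y}) ≤ ENNReal.ofReal (Real.exp y) * Q A := by
  have h1 := @measure_inter_log_rnDeriv_lt_le _ (obsField E s n) _ _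
    (isFiniteMeasure_restr s n P) (isFiniteMeasure_restr s n Q) h A y
  have hB : MeasurableSet[obsField E s n] {ω | logLik s n P Q ω < y} :=
    measurable_logLik_obsField s n P Q measurableSet_Iio
  rw [← trim_measurableSet_eq (obsField_le s n) hA,
    ← trim_measurableSet_eq (obsField_le s n) (hA.inter hB)]
  exact h1

theorem likRatio_div_likRatio_ae_eq {s : Finset (Fin K)} {n : ℕ} {P Q R : Measure (Traj E)}
    [IsFiniteMeasure P] [IsFiniteMeasure Q] [IsFiniteMeasure R]
    (hQP : @Measure.AbsolutelyContinuous _ (obsField E s n) (restr s n Q) (restr s n P))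
    (hPQ : @Measure.AbsolutelyContinuous _ (obsField E s n) (restr s n P) (restr s n Q))
    (hPR : @Measure.AbsolutelyContinuous _ (obsField E s n) (restr s n P) (restr s n R)) :
    ∀ᵐ ω ∂P, likRatio s n Q R ω / likRatio s n P R ω = (likRatio s n P Q ω)⁻¹ :=
  ae_of_ae_trim (obsField_le s n) (@rnDeriv_div_rnDeriv_ae_eq _ (obsField E s n) _ _ _
    (isFiniteMeasure_restr s n P) (isFiniteMeasure_restr s n Q) (isFiniteMeasure_restr s n R)
    hQP hPQ hPR)

theorem likRatio_pos_ae {s : Finset (Fin K)} {n : ℕ} {P Q : Measure (Traj E)}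
    [IsFiniteMeasure P] [IsFiniteMeasure Q]
    (hPQ : @Measure.AbsolutelyContinuous _ (obsField E s n) (restr s n P) (restr s n Q)) :
    ∀ᵐ ω ∂P, 0 < likRatio s n P Q ω ∧ likRatio s n P Q ω ≠ ∞ := by
  have _i1 := isFiniteMeasure_restr s n P
  have _i2 := isFiniteMeasure_restr s n Q
  have h1 := @Measure.rnDeriv_pos _ (obsField E s n) _ _ inferInstance hPQ
  have h2 := hPQ.ae_le (@Measure.rnDeriv_lt_top _ (obsField E s n)
    (restr s n P) (restr s n Q) inferInstance)
  filter_upwards [ae_of_ae_trim (obsField_le s n) h1, ae_of_ae_trim (obsField_le s n) h2]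
    with ω h1 h2
  exact ⟨h1, h2.ne⟩

theorem isInfo_info {s : Finset (Fin K)} {P Q : Measure (Traj E)} (h : ∃ r, IsInfo s P Q r) :
    IsInfo s P Q (info s P Q) := by
  rw [info, dif_pos h]
  exact h.choose_spec

end Paths

/-! ### Lower bound at a fixed horizon -/

namespace Model

variable {K : ℕ} {E : Fin K → Type*} [∀ k, MeasurableSpace (E k)] {M : Model E}

theorem isProbabilityMeasure_of_mem_compatible {Φ : Set (Finset (Finset (Fin K)))}
    {P : Measure (Traj E)} (hP : P ∈ M.compatible Φ) : IsProbabilityMeasure P :=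
  M.dists_prob P hP.1

theorem finite_altAt (e : Finset (Fin K)) : (M.altAt e).Finite :=
  M.dists_finite.subset fun _ h => h.1.1

theorem signals_eq_empty {P : Measure (Traj E)} (hP : P ∈ M.globalNull) : M.signals P = ∅ :=
  hP.2.2

theorem altAt_subset_diff (e : Finset (Fin K)) : M.altAt e ⊆ M.plausible \ M.globalNull := by
  rintro G ⟨hG, he⟩
  refine ⟨hG, fun h => ?_⟩
  rw [signals_eq_empty h] at he
  simp at he

theorem globalNull_subset_plausible (hempty : ∅ ∈ M.configs) : M.globalNull ⊆ M.plausible := by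
  rintro P ⟨h1, h2, h3⟩
  refine ⟨h1, h2, ?_⟩
  rw [Set.mem_singleton_iff.mp h3]
  exact hempty

/-- Under the global null any non-empty decision is a false positive; elsewhere the signal set is
non-empty, so an empty decision is a false negative. -/
theorem FwerClass.detClass (hempty : ∅ ∈ M.configs) {γ δ : ℝ} {T : Traj E → ℕ∞}
    {D : Traj E → Finset (Finset (Fin K))} (h : M.FwerClass γ δ T D) : M.DetClass γ δ T D where
  test := h.test
  false_alarm P hP := by
    simpa [signals_eq_empty hP] using h.false_positive P (globalNull_subset_plausible hempty hP)
  missed_detection P hP := by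
    refine (measure_mono ?_).trans (h.false_negative P hP.1)
    rintro ω ⟨h1, h2⟩
    refine ⟨h1, ?_⟩
    rw [h2, Finset.sdiff_empty]
    exact fun h0 => hP.2 ⟨hP.1.1, hP.1.2.1, h0⟩

/-- The subtracted terms bound P(T ≤ n): false alarm, log-likelihood crossing `y`, and empty
decision below `y`, the last moved from `P` to `G` at cost exp(y). Markov's inequality for T ≥ n + 1
does the rest. -/
theorem mul_one_sub_le_expectedTime (hempty : ∅ ∈ M.configs) {α β : ℝ} {T : Traj E → ℕ∞}
    {D : Traj E → Finset (Finset (Fin K))} (h : M.DetClass α β T D) {P G : Measure (Traj E)}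
    (hP : P ∈ M.globalNull) (hG : G ∈ M.plausible \ M.globalNull)
    (hPG : ∀ n, 1 ≤ n → @Measure.AbsolutelyContinuous _ (obsField E Finset.univ n)
      (restr Finset.univ n P) (restr Finset.univ n G)) (n : ℕ) (y : ℝ) :
    ((n : ℝ≥0∞) + 1) * (1 - (ENNReal.ofReal α +
        P {ω | ∃ m ∈ Finset.Icc 1 n, y ≤ logLik Finset.univ m P G ω} +
        ENNReal.ofReal (Real.exp y) * ENNReal.ofReal β)) ≤ expectedTime P T := by
  have := isProbabilityMeasure_of_mem_compatible hP
  have := isProbabilityMeasure_of_mem_compatible hG.1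
  set V : Set (Traj E) := {ω | ∃ m ∈ Finset.Icc 1 n, y ≤ logLik Finset.univ m P G ω}
  set W : ℕ → Set (Traj E) := fun m => {ω | T ω = m ∧ D ω = ∅}
  have hWm : ∀ m ∈ Finset.Icc 1 n, MeasurableSet[obsField E Finset.univ m] (W m) := fun m hm =>
    h.test.decision m (Finset.mem_Icc.mp hm).1 ∅ hempty
  have hW : P (⋃ m ∈ Finset.Icc 1 n, W m ∩ {ω | logLik Finset.univ m P G ω < y}) ≤
      ENNReal.ofReal (Real.exp y) * ENNReal.ofReal β := by
    calc P (⋃ m ∈ Finset.Icc 1 n, W m ∩ {ω | logLik Finset.univ m P G ω < y})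
        ≤ ∑ m ∈ Finset.Icc 1 n, P (W m ∩ {ω | logLik Finset.univ m P G ω < y}) :=
          measure_biUnion_finset_le _ _
      _ ≤ ∑ m ∈ Finset.Icc 1 n, ENNReal.ofReal (Real.exp y) * G (W m) :=
          Finset.sum_le_sum fun m hm =>
            measure_inter_logLik_lt_le (hPG m (Finset.mem_Icc.mp hm).1) (hWm m hm) y
      -- Disjointness over the stopping time merges the `G`-probabilities into one missed-detection
      -- event, so no factor `n` is lost.
      _ = ENNReal.ofReal (Real.exp y) * G (⋃ m ∈ Finset.Icc 1 n, W m) := by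
          rw [← Finset.mul_sum, measure_biUnion_finset]
          · intro i _ j _ hij
            refine Set.disjoint_left.mpr fun ω hi hj => hij ?_
            exact_mod_cast hi.1.symm.trans hj.1
          · exact fun m hm => obsField_le _ _ _ (hWm m hm)
      _ ≤ ENNReal.ofReal (Real.exp y) * ENNReal.ofReal β := by
          gcongr
          refine (measure_mono ?_).trans (h.missed_detection G hG)
          intro ω hω
          simp only [Set.mem_iUnion] at hω
          obtain ⟨m, -, h1, h2⟩ := hω
          exact ⟨by rw [h1]; exact ENat.natCast_ne_top m, h2⟩
  have hle : P {ω | T ω ≤ n} ≤ ENNReal.ofReal α + P V +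
      ENNReal.ofReal (Real.exp y) * ENNReal.ofReal β := by
    calc P {ω | T ω ≤ n} ≤ P ({ω | T ω ≠ ⊤ ∧ D ω ≠ ∅} ∪ V ∪
          ⋃ m ∈ Finset.Icc 1 n, W m ∩ {ω | logLik Finset.univ m P G ω < y}) := by
          refine measure_mono fun ω (hω : T ω ≤ n) => ?_
          have htop : T ω ≠ ⊤ := ne_top_of_le_ne_top (ENat.natCast_ne_top n) hω
          by_cases hD : D ω = ∅
          · by_cases hV : ω ∈ V
            · exact Or.inl (Or.inr hV)
            · right
              obtain ⟨m, hm⟩ := ENat.ne_top_iff_exists.mp htop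
              have hm1 : m ∈ Finset.Icc 1 n := by
                have h1 := h.test.one_le ω
                rw [← hm] at h1 hω
                exact Finset.mem_Icc.mpr ⟨by exact_mod_cast h1, by exact_mod_cast hω⟩
              simp only [Set.mem_iUnion]
              exact ⟨m, hm1, ⟨hm.symm, hD⟩, not_le.mp fun hy => hV ⟨m, hm1, hy⟩⟩
          · exact Or.inl (Or.inl ⟨htop, hD⟩)
      _ ≤ _ := (measure_union_le _ _).trans
          (add_le_add ((measure_union_le _ _).trans
            (add_le_add (h.false_alarm P hP) le_rfl)) hW)
  have hmeas : MeasurableSet {ω | T ω ≤ n} := by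
    have : {ω | T ω ≤ n} = ⋃ m ∈ Finset.Icc 1 n, {ω | T ω = m} := by
      ext ω
      simp only [Set.mem_ofPred_eq, Set.mem_iUnion, Finset.mem_Icc, exists_prop]
      constructor
      · intro hω
        obtain ⟨m, hm⟩ := ENat.ne_top_iff_exists.mp (ne_top_of_le_ne_top (ENat.natCast_ne_top n) hω)
        have h1 := h.test.one_le ω
        rw [← hm] at h1 hω
        exact ⟨m, ⟨by exact_mod_cast h1, by exact_mod_cast hω⟩, hm.symm⟩
      · rintro ⟨m, hm, h1⟩
        rw [h1]
        exact_mod_cast hm.2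
    rw [this]
    exact Finset.measurableSet_biUnion _ fun m hm =>
      obsField_le _ _ _ (h.test.stopping m (Finset.mem_Icc.mp hm).1)
  calc _ ≤ ((n : ℝ≥0∞) + 1) * P {ω | T ω ≤ n}ᶜ := by
        rw [prob_compl_eq_one_sub hmeas]
        gcongr
    _ = ∫⁻ ω, {ω | T ω ≤ n}ᶜ.indicator (fun _ => (n : ℝ≥0∞) + 1) ω ∂P := by
        rw [lintegral_indicator_const hmeas.compl]
    _ ≤ expectedTime P T := by
        refine lintegral_mono fun ω => Set.indicator_apply_le' (fun hω => ?_) fun _ => zero_le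
        have h1 : ((n : ℕ∞) : ℕ∞) + 1 ≤ T ω := Order.add_one_le_of_lt (not_le.mp hω)
        have h2 := ENat.toENNReal_le.mpr h1
        simpa using h2

end Model

/-! ### Upper bound for T_0 at given thresholds -/

namespace Design

variable {K : ℕ} {E : Fin K → Type*} [∀ k, MeasurableSpace (E k)] {M : Model E} (S : Design M)

/-- The maximum over the global null is at least the term of `P`, so the statistic is at most the
largest reciprocal of a likelihood ratio of `P` against an alternative. The exceptional null set
depends only on countably many `n`, `e`, `G`, not on `c`. -/
theorem detStat_le_of_logLik_ge_ae (hAC : M.MutuallyAC) {P : Measure (Traj E)}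
    (hP : P ∈ M.globalNull) :
    ∀ᵐ ω ∂P, ∀ n, 1 ≤ n → ∀ e ∈ M.units, ∀ c : ℝ, 0 < c →
      (∀ G ∈ M.altAt e, Real.log c ≤ logLik (S.detSub e) n P G ω) →
      S.detStat e n ω ≤ ENNReal.ofReal (1 / c) := by
  have := Model.isProbabilityMeasure_of_mem_compatible hP
  have key : ∀ᵐ ω ∂P, ∀ n, 1 ≤ n → ∀ e ∈ M.units, ∀ G ∈ M.altAt e,
      likRatio (S.detSub e) n G (S.detRef e) ω / likRatio (S.detSub e) n P (S.detRef e) ω =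
        (likRatio (S.detSub e) n P G ω)⁻¹ ∧
      (0 < likRatio (S.detSub e) n P G ω ∧ likRatio (S.detSub e) n P G ω ≠ ∞) := by
    refine ae_all_iff.mpr fun n => ae_all_iff.mpr fun hn =>
      (ae_ball_iff (Finset.countable_toSet M.units)).mpr fun e he => ?_
    refine (ae_ball_iff (Model.finite_altAt e).countable).mpr fun G hG => ?_
    have := Model.isProbabilityMeasure_of_mem_compatible hG.1
    have := Model.isProbabilityMeasure_of_mem_compatible (S.detRef_mem e he)
    obtain ⟨h1, h2⟩ := hAC e he G (Or.inl hG) P (Or.inr hP) _ (S.subset_detSub e he) n hn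
    have h3 := (hAC e he P (Or.inr hP) _ (Or.inr (S.detRef_mem e he)) _
      (S.subset_detSub e he) n hn).1
    filter_upwards [likRatio_div_likRatio_ae_eq h1 h2 h3, likRatio_pos_ae h2] with ω h4 h5
    exact ⟨h4, h5⟩
  filter_upwards [key] with ω hω n hn e he c hc hlog
  calc S.detStat e n ω
      ≤ (⨆ G ∈ M.altAt e, likRatio (S.detSub e) n G (S.detRef e) ω) /
          likRatio (S.detSub e) n P (S.detRef e) ω :=
        ENNReal.div_le_div_left
          (le_iSup₂ (f := fun Q _ => likRatio (S.detSub e) n Q (S.detRef e) ω) P hP) _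
    _ ≤ ENNReal.ofReal (1 / c) := by
        simp only [ENNReal.iSup_div]
        refine iSup₂_le fun G hG => ?_
        obtain ⟨h1, h2, h3⟩ := hω n hn e he G hG
        rw [h1, one_div, ENNReal.ofReal_inv_of_pos hc, ENNReal.inv_le_inv,
          ENNReal.ofReal_le_iff_le_toReal h3]
        exact (Real.log_le_log_iff hc (ENNReal.toReal_pos h2.ne' h3)).mp (hlog G hG)

/-- The event that some detection log-likelihood ratio of `P` is below the line of slope `ρ`
at time `n`. -/
def slowEvent (P : Measure (Traj E)) (ρ : ℝ) (n : ℕ) : Set (Traj E) :=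
  ⋃ e ∈ M.units, ⋃ G ∈ M.altAt e, {ω | logLik (S.detSub e) n P G ω < (n : ℝ) * ρ}

theorem measurableSet_slowEvent (P : Measure (Traj E)) (ρ : ℝ) (n : ℕ) :
    MeasurableSet (S.slowEvent P ρ n) :=
  Finset.measurableSet_biUnion _ fun e _ =>
    (Model.finite_altAt e).measurableSet_biUnion fun G _ =>
      measurable_logLik (S.detSub e) n P G measurableSet_Iio

/-- A union bound over finitely many pairs reduces this to the summability built into each
information number. -/
theorem tsum_measure_slowEvent_lt_top (hInfo : M.HasInfo) {P : Measure (Traj E)}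
    (hP : P ∈ M.globalNull) {ρ : ℝ}
    (hρ : ∀ e ∈ M.units, ∀ G ∈ M.altAt e, ρ < info (S.detSub e) P G) :
    ∑' n : ℕ, P (S.slowEvent P ρ (n + 1)) < ∞ := by
  calc ∑' n : ℕ, P (S.slowEvent P ρ (n + 1))
      ≤ ∑' n : ℕ, ∑ e ∈ M.units, ∑ G ∈ (Model.finite_altAt (M := M) e).toFinset,
          P {ω | logLik (S.detSub e) (n + 1) P G ω < ((n + 1 : ℕ) : ℝ) * ρ} := by
        refine ENNReal.tsum_le_tsum fun n => (measure_biUnion_finset_le _ _).trans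
          (Finset.sum_le_sum fun e _ => ?_)
        refine le_trans (le_of_eq ?_) (measure_biUnion_finset_le _ _)
        simp
    _ = ∑ e ∈ M.units, ∑ G ∈ (Model.finite_altAt (M := M) e).toFinset, ∑' n : ℕ,
          P {ω | logLik (S.detSub e) (n + 1) P G ω < ((n + 1 : ℕ) : ℝ) * ρ} := by
        rw [Summable.tsum_finsetSum fun _ _ => ENNReal.summable]
        exact Finset.sum_congr rfl fun e _ =>
          Summable.tsum_finsetSum fun _ _ => ENNReal.summable
    _ < ∞ := by
        refine ENNReal.sum_lt_top.mpr fun e he => ENNReal.sum_lt_top.mpr fun G hG => ?_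
        rw [Set.Finite.mem_toFinset] at hG
        exact (isInfo_info (hInfo e he G hG P (Or.inr hP) _
          (S.subset_detSub e he)).2).lower ρ (hρ e he G hG)

/-- From time `N` on, the line of slope `ρ` is above every log-threshold, so T_0 can be delayed only
by slow events. The thresholds enter only through `N`; the sum is a constant. -/
theorem expectedTime_timeNull_le (hAC : M.MutuallyAC) {P : Measure (Traj E)}
    (hP : P ∈ M.globalNull) {ρ : ℝ} (hρ : 0 ≤ ρ) {N : ℕ} (hN : 1 ≤ N)
    {C : Finset (Fin K) → ℝ} (hC : ∀ e ∈ M.units, 0 < C e)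
    (hCN : ∀ e ∈ M.units, Real.log (C e) ≤ N * ρ) :
    expectedTime P (S.timeNull C) ≤ N + ∑' n : ℕ, P (S.slowEvent P ρ (n + 1)) := by
  classical
  have := Model.isProbabilityMeasure_of_mem_compatible hP
  calc expectedTime P (S.timeNull C)
      ≤ ∫⁻ ω, (N + ∑' n : ℕ, (S.slowEvent P ρ (n + 1)).indicator 1 ω) ∂P := by
        refine lintegral_mono_ae ?_
        filter_upwards [S.detStat_le_of_logLik_ge_ae hAC hP] with ω hω
        refine (coe_firstTime_le_add_tsum _ hN).trans (add_le_add le_rfl ?_)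
        -- Slow events are indexed from time 1, so counting from `N` is a shift of the index by `N -
        -- 1`.
        have hinj : Function.Injective fun n : ℕ => N - 1 + n := add_right_injective _
        refine le_trans (ENNReal.tsum_le_tsum fun n => ?_)
          (ENNReal.tsum_comp_le_tsum_of_injective hinj
            fun n => (S.slowEvent P ρ (n + 1)).indicator (1 : Traj E → ℝ≥0∞) ω)
        have hn : N - 1 + n + 1 = N + n := by omega
        simp only [hn]
        by_cases hs : ω ∈ S.slowEvent P ρ (N + n)
        · rw [Set.indicator_of_mem hs]
          split_ifs <;> simp
        · rw [if_pos]
          · exact zero_le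
          · intro e he
            refine hω (N + n) (by omega) e he (C e) (hC e he) fun G hG => ?_
            refine not_lt.mp fun hlt => hs ?_
            simp only [slowEvent, Set.mem_iUnion]
            refine ⟨e, he, G, hG, hlt.trans_le ((hCN e he).trans ?_)⟩
            push_cast
            nlinarith [(Nat.cast_nonneg n : (0 : ℝ) ≤ n)]
    _ = N + ∑' n : ℕ, P (S.slowEvent P ρ (n + 1)) := by
        rw [lintegral_add_left measurable_const, lintegral_tsum]
        · simp [lintegral_indicator_one (S.measurableSet_slowEvent P ρ _)]
        · exact fun n =>
            (measurable_one.indicator (S.measurableSet_slowEvent P ρ _)).aemeasurable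

end Design

/-! ### Asymptotic equivalence and limit regimes -/

theorem AsympEq.of_bounds {X : Type*} {l : Filter X} {f g : X → ℝ≥0∞}
    (hg : ∀ᶠ x in l, g x ≠ 0 ∧ g x ≠ ∞)
    (hlow : ∀ c ∈ Set.Ioo (0 : ℝ) 1, ∀ᶠ x in l, ENNReal.ofReal c * g x ≤ f x)
    (hupp : ∀ c : ℝ, 1 < c → ∀ᶠ x in l, f x ≤ ENNReal.ofReal c * g x) :
    AsympEq l f g ∧ AsympEq l g f := by
  have h : AsympEq l f g := by
    refine tendsto_order.mpr ⟨fun a ha => ?_, fun a ha => ?_⟩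
    · obtain ⟨c, hac, hc⟩ := exists_between ha
      have hct : c ≠ ∞ := hc.ne_top
      have h0 : 0 < c.toReal := ENNReal.toReal_pos (zero_le.trans_lt hac).ne' hct
      have h1 : c.toReal < 1 := by
        simpa using (ENNReal.toReal_lt_toReal hct ENNReal.one_ne_top).mpr hc
      filter_upwards [hg, hlow c.toReal ⟨h0, h1⟩] with x hx hx'
      rw [ENNReal.ofReal_toReal hct] at hx'
      exact hac.trans_le ((ENNReal.le_div_iff_mul_le (Or.inl hx.1) (Or.inl hx.2)).mpr hx')
    · obtain ⟨c, hc, hca⟩ := exists_between ha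
      have hct : c ≠ ∞ := hca.ne_top
      have h1 : 1 < c.toReal := by
        simpa using (ENNReal.toReal_lt_toReal ENNReal.one_ne_top hct).mpr hc
      filter_upwards [hg, hupp c.toReal h1] with x hx hx'
      rw [ENNReal.ofReal_toReal hct] at hx'
      exact ((ENNReal.div_le_iff_le_mul (Or.inl hx.1) (Or.inl hx.2)).mpr hx').trans_lt hca
  refine ⟨h, ?_⟩
  have h2 : Tendsto (fun x => (f x / g x)⁻¹) l (𝓝 1⁻¹) := tendsto_inv_iff.mpr h
  rw [inv_one] at h2
  refine h2.congr' ?_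
  filter_upwards [hg] with x hx
  exact ENNReal.inv_div (Or.inl hx.2) (Or.inl hx.1)

theorem tendsto_abs_log_atTop {X : Type*} {l : Filter X} {b : X → ℝ}
    (hb : Tendsto b l (𝓝[>] 0)) : Tendsto (fun x => |Real.log (b x)|) l atTop :=
  tendsto_abs_atBot_atTop.comp (Real.tendsto_log_nhdsGT_zero.comp hb)

theorem eventually_mem_Ioo_of_tendsto_nhdsGT {X : Type*} {l : Filter X} {b : X → ℝ}
    (hb : Tendsto b l (𝓝[>] 0)) : ∀ᶠ x in l, b x ∈ Set.Ioo (0 : ℝ) 1 :=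
  hb.eventually (Ioo_mem_nhdsGT one_pos)

theorem IsRegime.eventually_mem_Ioo {l : Filter ℝ} (h : IsRegime l) :
    ∀ᶠ x in l, x ∈ Set.Ioo (0 : ℝ) 1 := by
  rcases h with rfl | ⟨c, hc, rfl⟩
  · exact Ioo_mem_nhdsGT one_pos
  · exact hc

/-! ### The optimal rate and the asymptotic lower bound -/

namespace Model

variable {K : ℕ} {E : Fin K → Type*} [∀ k, MeasurableSpace (E k)] {M : Model E}

theorem info_pos (hInfo : M.HasInfo) {P G : Measure (Traj E)} (hP : P ∈ M.globalNull)
    {e s : Finset (Fin K)} (he : e ∈ M.units) (hG : G ∈ M.altAt e) (hs : e ⊆ s) :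
    0 < info s P G :=
  (isInfo_info (hInfo e he G hG P (Or.inr hP) s hs).2).pos

/-- The least information number of `P` against the alternatives is attained. -/
theorem exists_iInf_infoSet_eq (P : Measure (Traj E)) (hG : ∃ e ∈ M.units, (M.altAt e).Nonempty) :
    ∃ e ∈ M.units, ∃ G ∈ M.altAt e,
      (⨅ e ∈ M.units, infoSet Finset.univ P (M.altAt e)) =
        ENNReal.ofReal (info Finset.univ P G) := by
  have hfin : (⋃ e ∈ M.units, M.altAt e).Finite :=
    M.units.finite_toSet.biUnion fun e _ => finite_altAt e
  have hne : (⋃ e ∈ M.units, M.altAt e).Nonempty := by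
    obtain ⟨e, he, G, hG⟩ := hG
    exact ⟨G, Set.mem_biUnion (s := (M.units : Set (Finset (Fin K)))) he hG⟩
  obtain ⟨G, hGm, hmin⟩ := Set.exists_min_image _ (fun G => info Finset.univ P G) hfin hne
  simp only [Set.mem_iUnion] at hGm hmin
  obtain ⟨e, he, hGe⟩ := hGm
  refine ⟨e, he, G, hGe, le_antisymm ?_ ?_⟩
  · exact (iInf₂_le e he).trans (iInf₂_le G hGe)
  · exact le_iInf₂ fun e' he' => le_iInf₂ fun G' hG' =>
      ENNReal.ofReal_le_ofReal (hmin G' ⟨e', he', hG'⟩)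

/-- Inversion turns an infimum into a supremum in `ℝ≥0∞`; units without alternatives have
information ∞ and contribute 0. -/
theorem rate_eq (P : Measure (Traj E)) (x : ℝ) :
    M.rate P x = ENNReal.ofReal |Real.log x| /
      ⨅ e ∈ M.units, infoSet Finset.univ P (M.altAt e) := by
  simp only [rate, ENNReal.div_eq_inv_mul, ENNReal.inv_iInf, ENNReal.iSup_mul]

/-- Asymptotic lower bound for the expected sample size of all tests that detect. -/
theorem eventually_le_expectedTime (hAC : M.MutuallyAC) (hInfo : M.HasInfo)
    (hempty : ∅ ∈ M.configs) {P G : Measure (Traj E)} (hP : P ∈ M.globalNull)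
    {e : Finset (Fin K)} (he : e ∈ M.units) (hG : G ∈ M.altAt e)
    {X : Type*} {l : Filter X} {a b : X → ℝ} (ha : Tendsto a l (𝓝[>] 0))
    (hb : Tendsto b l (𝓝[>] 0)) {c : ℝ} (hc : c ∈ Set.Ioo (0 : ℝ) 1) :
    ∀ᶠ x in l, ∀ (T : Traj E → ℕ∞) (D : Traj E → Finset (Finset (Fin K))),
      M.DetClass (a x) (b x) T D →
      ENNReal.ofReal c * ENNReal.ofReal (|Real.log (b x)| / info Finset.univ P G) ≤
        expectedTime P T := by
  obtain ⟨hc0, hc1⟩ := hc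
  have hI := isInfo_info (hInfo e he G hG P (Or.inr hP) _ (Finset.subset_univ e)).2
  set r := info Finset.univ P G
  have hr : 0 < r := hI.pos
  -- Three factors `d` are lost: in the slope `ρ = r / d`, in the horizon, and in the probability of
  -- not stopping. This choice gives c = 3d - 2 ≤ d³, as d³ - 3d + 2 = (1 - d)²(d + 2).
  obtain ⟨d, hd⟩ : ∃ d : ℝ, d = (2 + c) / 3 := ⟨_, rfl⟩
  have hd0 : 0 < d := by rw [hd]; linarith
  have hd1 : d < 1 := by rw [hd]; linarith
  have hcd : c ≤ d * d * d := by
    have : c = 3 * d - 2 := by rw [hd]; ring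
    rw [this]
    nlinarith [mul_nonneg (sq_nonneg (1 - d)) (by linarith : (0 : ℝ) ≤ d + 2)]
  have hL := tendsto_abs_log_atTop hb
  set L : X → ℝ := fun x => |Real.log (b x)|
  set ρ : ℝ := r / d
  have hρ : 0 < ρ := div_pos hr hd0
  have hrρ : r < ρ := by rw [lt_div_iff₀ hd0]; nlinarith
  -- The crossing level `n x * ρ` is then at most `d * L x`, so exp(level) times `b x` is at most
  -- exp(-(1 - d) L), which vanishes.
  set n : X → ℕ := fun x => ⌊d * L x / ρ⌋₊
  have hn : Tendsto n l atTop :=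
    tendsto_nat_floor_atTop.comp ((hL.const_mul_atTop hd0).atTop_div_const hρ)
  have h1 : Tendsto (fun x => ENNReal.ofReal (a x)) l (𝓝 0) := by
    simpa using ENNReal.tendsto_ofReal (tendsto_nhds_of_tendsto_nhdsWithin ha)
  have h2 := (hI.upper ρ hrρ).comp hn
  have h3 : Tendsto (fun x => ENNReal.ofReal (Real.exp (-((1 - d) * L x)))) l (𝓝 0) := by
    have : Tendsto (fun x => Real.exp (-((1 - d) * L x))) l (𝓝 0) :=
      Real.tendsto_exp_neg_atTop_nhds_zero.comp (hL.const_mul_atTop (by linarith))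
    simpa using ENNReal.tendsto_ofReal this
  have h4 := (h1.add h2).add h3
  rw [add_zero, add_zero] at h4
  have hpos : (0 : ℝ≥0∞) < ENNReal.ofReal (1 - d) := ENNReal.ofReal_pos.mpr (by linarith)
  filter_upwards [h4.eventually_le_const hpos, eventually_mem_Ioo_of_tendsto_nhdsGT hb]
    with x hx hbx T D hT
  have hLx : 0 ≤ L x := abs_nonneg _
  have hbL : b x = Real.exp (-L x) := by
    have : L x = -Real.log (b x) := abs_of_neg (Real.log_neg hbx.1 hbx.2)
    rw [this, neg_neg, Real.exp_log hbx.1]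
  have hnle : (n x : ℝ) * ρ ≤ d * L x :=
    (le_div_iff₀ hρ).mp (Nat.floor_le (by positivity))
  have hnge : d * d * (L x / r) ≤ (n x : ℝ) + 1 := by
    refine le_trans (le_of_eq ?_) (Nat.lt_floor_add_one (d * L x / ρ)).le
    simp only [ρ]
    field_simp
  refine le_trans ?_ (mul_one_sub_le_expectedTime hempty hT hP
    (altAt_subset_diff e hG) (fun n hn => (hAC e he G (Or.inl hG) P (Or.inr hP) _
      (Finset.subset_univ e) n hn).2) (n x) ((n x : ℝ) * ρ))
  have hexp : ENNReal.ofReal (Real.exp ((n x : ℝ) * ρ)) * ENNReal.ofReal (b x) ≤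
      ENNReal.ofReal (Real.exp (-((1 - d) * L x))) := by
    rw [← ENNReal.ofReal_mul (Real.exp_pos _).le, hbL, ← Real.exp_add]
    exact ENNReal.ofReal_le_ofReal (Real.exp_le_exp.mpr (by linarith))
  calc ENNReal.ofReal c * ENNReal.ofReal (L x / r)
      ≤ ENNReal.ofReal ((n x : ℝ) + 1) * ENNReal.ofReal d := by
        rw [← ENNReal.ofReal_mul hc0.le, ← ENNReal.ofReal_mul (by positivity)]
        refine ENNReal.ofReal_le_ofReal ?_
        have : 0 ≤ L x / r := by positivity
        nlinarith [mul_le_mul_of_nonneg_right hcd this, mul_le_mul_of_nonneg_right hnge hd0.le]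
    _ ≤ _ := by
        rw [ENNReal.ofReal_add (by positivity) zero_le_one, ENNReal.ofReal_natCast,
          ENNReal.ofReal_one]
        gcongr
        have hd' : ENNReal.ofReal d = 1 - ENNReal.ofReal (1 - d) := by
          rw [← ENNReal.ofReal_one, ← ENNReal.ofReal_sub _ (by linarith)]
          congr 1
          ring
        rw [hd']
        exact tsub_le_tsub_left ((add_le_add le_rfl hexp).trans hx) _

end Model

/-! ### Asymptotic upper bound and optimality -/

namespace Design

variable {K : ℕ} {E : Fin K → Type*} [∀ k, MeasurableSpace (E k)] {M : Model E} (S : Design M)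

/-- Asymptotic upper bound for the expected value of `T_0`. -/
theorem eventually_expectedTime_timeNull_le (hAC : M.MutuallyAC) (hInfo : M.HasInfo)
    {P : Measure (Traj E)} (hP : P ∈ M.globalNull) {r : ℝ} (hr : 0 < r)
    (hrI : ∀ e ∈ M.units, ∀ G ∈ M.altAt e, r ≤ info (S.detSub e) P G)
    {X : Type*} {l : Filter X} {b : X → ℝ} (hb : Tendsto b l (𝓝[>] 0))
    {C : X → Finset (Fin K) → ℝ} (hCpos : ∀ᶠ x in l, ∀ e ∈ M.units, 0 < C x e)
    (hC : ∀ e ∈ M.units, Tendsto (fun x => Real.log (C x e) / |Real.log (b x)|) l (𝓝 1))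
    {c : ℝ} (hc : 1 < c) :
    ∀ᶠ x in l, expectedTime P (S.timeNull (C x)) ≤
      ENNReal.ofReal c * ENNReal.ofReal (|Real.log (b x)| / r) := by
  have hL := tendsto_abs_log_atTop hb
  set L : X → ℝ := fun x => |Real.log (b x)|
  -- One factor `d` covers log C ≤ d L, the other the slope `r / d`; the gap c - d² is left to
  -- absorb constants.
  obtain ⟨d, hd1, hdc⟩ : ∃ d : ℝ, 1 < d ∧ d * d < c := by
    refine ⟨√((1 + c) / 2), ?_, ?_⟩
    · rw [Real.lt_sqrt zero_le_one]; linarith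
    · rw [Real.mul_self_sqrt (by linarith)]; linarith
  have hd0 : 0 < d := by linarith
  set ρ : ℝ := r / d
  have hρ : 0 < ρ := div_pos hr hd0
  have hρr : ρ < r := div_lt_self hr hd1
  have hU := S.tsum_measure_slowEvent_lt_top hInfo hP
    fun e he G hG => hρr.trans_le (hrI e he G hG)
  obtain ⟨u, hu⟩ : ∃ u : ℝ, u = (∑' n : ℕ, P (S.slowEvent P ρ (n + 1))).toReal := ⟨_, rfl⟩
  have hu0 : 0 ≤ u := hu ▸ ENNReal.toReal_nonneg
  have hlog : ∀ᶠ x in l, ∀ e ∈ M.units, Real.log (C x e) / L x ≤ d :=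
    (Finset.eventually_all M.units).mpr fun e he => (hC e he).eventually_le_const hd1
  -- The last bound on `L` makes (c - d²) L / r at least 1 + u: 1 from rounding up the horizon, `u`
  -- from the slow events.
  filter_upwards [hCpos, hlog, hL.eventually_gt_atTop 0,
    hL.eventually_ge_atTop ((1 + u) * r / (c - d * d))] with x hx hx' hLx hLx'
  have hN : 1 ≤ ⌈d * L x / ρ⌉₊ := Nat.one_le_ceil_iff.mpr (by positivity)
  refine (S.expectedTime_timeNull_le hAC hP hρ.le hN hx fun e he => ?_).trans ?_
  · have h1 := (div_le_iff₀ hLx).mp (hx' e he)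
    exact h1.trans ((div_le_iff₀ hρ).mp (Nat.le_ceil _))
  · have h1 : (⌈d * L x / ρ⌉₊ : ℝ) ≤ d * d * (L x / r) + 1 := by
      refine (Nat.ceil_lt_add_one (by positivity)).le.trans (le_of_eq ?_)
      simp only [ρ]
      field_simp
    have h2 : 1 + u ≤ (c - d * d) * (L x / r) := by
      rw [div_le_iff₀ (by linarith)] at hLx'
      rw [← mul_div_assoc, le_div_iff₀ hr]
      linarith
    rw [← ENNReal.ofReal_toReal hU.ne, ← hu, ← ENNReal.ofReal_natCast,
      ← ENNReal.ofReal_add (by positivity) hu0, ← ENNReal.ofReal_mul (by linarith)]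
    exact ENNReal.ofReal_le_ofReal (by linarith)

/-- A procedure that detects and stops no later than `T_0` is asymptotically optimal under the
global null, within any class of detecting tests that contains it. -/
theorem asympEq_expectedTime_optTime (hAC : M.MutuallyAC) (hInfo : M.HasInfo)
    (hempty : ∅ ∈ M.configs) {P : Measure (Traj E)} (hP : P ∈ M.globalNull)
    (hG : ∃ e ∈ M.units, (M.altAt e).Nonempty) (hS : S.DetSubLarge P)
    {X : Type*} {l : Filter X} {a b : X → ℝ} (ha : Tendsto a l (𝓝[>] 0))
    (hb : Tendsto b l (𝓝[>] 0))
    {𝒞 : X → (Traj E → ℕ∞) → (Traj E → Finset (Finset (Fin K))) → Prop}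
    (h𝒞 : ∀ x T D, 𝒞 x T D → M.DetClass (a x) (b x) T D)
    {T : X → Traj E → ℕ∞} {D : X → Traj E → Finset (Finset (Fin K))}
    {C : X → Finset (Fin K) → ℝ}
    (hTD : ∀ᶠ x in l, (∀ e ∈ M.units, 0 < C x e) ∧ 𝒞 x (T x) (D x))
    (hT : ∀ x ω, T x ω ≤ S.timeNull (C x) ω)
    (hC : ∀ e ∈ M.units, Tendsto (fun x => Real.log (C x e) / |Real.log (b x)|) l (𝓝 1)) :
    AsympEq l (fun x => expectedTime P (T x)) (fun x => M.rate P (b x)) ∧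
      AsympEq l (fun x => M.rate P (b x)) (fun x => optTime P (𝒞 x)) := by
  obtain ⟨e, he, G, hGe, hmin⟩ := Model.exists_iInf_infoSet_eq (M := M) P hG
  have hr : 0 < info Finset.univ P G := Model.info_pos hInfo hP he hGe (Finset.subset_univ e)
  -- Equality of the two minima lets the full-system information of `G` bound every subsystem
  -- information from below, so upper and lower bounds share one rate.
  have hrI : ∀ e ∈ M.units, ∀ Q ∈ M.altAt e,
      info Finset.univ P G ≤ info (S.detSub e) P Q := by
    intro e' he' Q hQ
    rw [← ENNReal.ofReal_le_ofReal_iff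
      (Model.info_pos hInfo hP he' hQ (S.subset_detSub e' he')).le, ← hmin, ← hS]
    exact (iInf₂_le e' he').trans (iInf₂_le Q hQ)
  have hrate : ∀ x, M.rate P (b x) =
      ENNReal.ofReal (|Real.log (b x)| / info Finset.univ P G) := fun x => by
    rw [Model.rate_eq, hmin, ENNReal.ofReal_div_of_pos hr]
  have hne : ∀ᶠ x in l, M.rate P (b x) ≠ 0 ∧ M.rate P (b x) ≠ ∞ := by
    filter_upwards [(tendsto_abs_log_atTop hb).eventually_gt_atTop 0] with x hx
    rw [hrate]
    exact ⟨(ENNReal.ofReal_pos.mpr (by positivity)).ne', ENNReal.ofReal_ne_top⟩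
  have hlow : ∀ c ∈ Set.Ioo (0 : ℝ) 1, ∀ᶠ x in l,
      ENNReal.ofReal c * M.rate P (b x) ≤ optTime P (𝒞 x) := by
    intro c hc
    filter_upwards [Model.eventually_le_expectedTime hAC hInfo hempty hP he hGe ha hb hc]
      with x hx
    rw [hrate]
    exact le_iInf fun T' => le_iInf fun D' => le_iInf fun h => hx T' D' (h𝒞 x T' D' h)
  have hupp : ∀ c : ℝ, 1 < c → ∀ᶠ x in l,
      expectedTime P (T x) ≤ ENNReal.ofReal c * M.rate P (b x) := by
    intro c hc
    filter_upwards [S.eventually_expectedTime_timeNull_le hAC hInfo hP hr hrI hb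
      (hTD.mono fun _ h => h.1) hC hc] with x hx
    rw [hrate]
    exact (lintegral_mono fun ω => ENat.toENNReal_le.mpr (hT x ω)).trans hx
  -- Membership in the class puts the optimum below the procedure, so the lower bound for one and
  -- the upper bound for the other sandwich both.
  have hopt : ∀ᶠ x in l, optTime P (𝒞 x) ≤ expectedTime P (T x) :=
    hTD.mono fun x h => (iInf_le _ (T x)).trans ((iInf_le _ (D x)).trans (iInf_le _ h.2))
  constructor
  · refine (AsympEq.of_bounds hne (fun c hc => ?_) hupp).1
    filter_upwards [hlow c hc, hopt] with x h1 h2 using h1.trans h2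
  · refine (AsympEq.of_bounds hne hlow fun c hc => ?_).2
    filter_upwards [hupp c hc, hopt] with x h1 h2 using h2.trans h1

end Design

/-! ### The three testing problems -/

theorem mainTheorem3 {K : ℕ} {E : Fin K → Type*} [∀ k, MeasurableSpace (E k)]
    (M : Model E) (S : Design M) (hAC : M.MutuallyAC) (hInfo : M.HasInfo)
    (hempty : ∅ ∈ M.configs) (P : Measure (Traj E)) (hP : P ∈ M.globalNull)
    (hG : ∃ e ∈ M.units, (M.altAt e).Nonempty) :
    ((∀ e ∈ M.units, S.detSub e = Finset.univ) → S.DetSubLarge P) ∧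
    (S.DetSubLarge P →
      -- pure detection
      (∀ (C D : ℝ → ℝ → Finset (Fin K) → ℝ) (Δ : ℝ → ℝ → Traj E → Finset (Finset (Fin K))),
        (∀ α ∈ Set.Ioo (0 : ℝ) 1, ∀ β ∈ Set.Ioo (0 : ℝ) 1,
          (∀ e ∈ M.units, 0 < C α β e ∧ 0 < D α β e) ∧
          S.IsDetDecision (C α β) (D α β) (Δ α β) ∧
          M.DetClass α β (S.detTime (C α β) (D α β)) (Δ α β)) →
        (∀ e ∈ M.units, Tendsto (fun p : ℝ × ℝ => Real.log (C p.1 p.2 e) / |Real.log p.2|)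
          (𝓝[>] 0 ×ˢ 𝓝[>] 0) (𝓝 1)) →
        AsympEq (𝓝[>] 0 ×ˢ 𝓝[>] 0)
          (fun p : ℝ × ℝ => expectedTime P (S.detTime (C p.1 p.2) (D p.1 p.2)))
          (fun p => M.rate P p.2) ∧
        AsympEq (𝓝[>] 0 ×ˢ 𝓝[>] 0)
          (fun p : ℝ × ℝ => M.rate P p.2)
          (fun p => optTime P (M.DetClass p.1 p.2))) ∧
      -- joint detection and isolation
      (∀ τ : ℝ → ℝ → ℝ → ℝ → Thresholds K,
        (∀ α ∈ Set.Ioo (0 : ℝ) 1, ∀ β ∈ Set.Ioo (0 : ℝ) 1,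
          ∀ γ ∈ Set.Ioo (0 : ℝ) 1, ∀ δ ∈ Set.Ioo (0 : ℝ) 1,
          (∀ e ∈ M.units, 0 < (τ α β γ δ).A e ∧ 0 < (τ α β γ δ).B e ∧
            0 < (τ α β γ δ).C e ∧ 0 < (τ α β γ δ).D e) ∧
          M.JointClass α β γ δ (S.jointTime (τ α β γ δ)) (S.jointDecision (τ α β γ δ))) →
        ∀ lγ lδ : Filter ℝ, IsRegime lγ → IsRegime lδ →
        (∀ e ∈ M.units, Tendsto
          (fun p : ℝ × ℝ × ℝ × ℝ =>
            Real.log ((τ p.1 p.2.1 p.2.2.1 p.2.2.2).C e) / |Real.log p.2.1|)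
          (𝓝[>] 0 ×ˢ 𝓝[>] 0 ×ˢ lγ ×ˢ lδ) (𝓝 1)) →
        AsympEq (𝓝[>] 0 ×ˢ 𝓝[>] 0 ×ˢ lγ ×ˢ lδ)
          (fun p : ℝ × ℝ × ℝ × ℝ =>
            expectedTime P (S.jointTime (τ p.1 p.2.1 p.2.2.1 p.2.2.2)))
          (fun p => M.rate P p.2.1) ∧
        AsympEq (𝓝[>] 0 ×ˢ 𝓝[>] 0 ×ˢ lγ ×ˢ lδ)
          (fun p : ℝ × ℝ × ℝ × ℝ => M.rate P p.2.1)
          (fun p => optTime P (M.JointClass p.1 p.2.1 p.2.2.1 p.2.2.2))) ∧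
      -- familywise error control
      (∀ A B : ℝ → ℝ → Finset (Fin K) → ℝ,
        (∀ γ ∈ Set.Ioo (0 : ℝ) 1, ∀ δ ∈ Set.Ioo (0 : ℝ) 1,
          (∀ e ∈ M.units, 0 < A γ δ e ∧ 0 < B γ δ e) ∧
          M.FwerClass γ δ (S.jointTime ⟨A γ δ, B γ δ, A γ δ, B γ δ⟩)
            (S.jointDecision ⟨A γ δ, B γ δ, A γ δ, B γ δ⟩)) →
        (∀ e ∈ M.units, Tendsto (fun p : ℝ × ℝ => Real.log (A p.1 p.2 e) / |Real.log p.2|)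
          (𝓝[>] 0 ×ˢ 𝓝[>] 0) (𝓝 1)) →
        AsympEq (𝓝[>] 0 ×ˢ 𝓝[>] 0)
          (fun p : ℝ × ℝ => expectedTime P
            (S.jointTime ⟨A p.1 p.2, B p.1 p.2, A p.1 p.2, B p.1 p.2⟩))
          (fun p => M.rate P p.2) ∧
        AsympEq (𝓝[>] 0 ×ˢ 𝓝[>] 0)
          (fun p : ℝ × ℝ => M.rate P p.2)
          (fun p => optTime P (M.FwerClass p.1 p.2)))) := by
  refine ⟨fun h => ?_, fun hS => ⟨fun C D Δ h hC => ?_, fun τ h lγ lδ hγ hδ hC => ?_,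
    fun A B h hA => ?_⟩⟩
  · exact iInf_congr fun e => iInf_congr fun he => by rw [h e he]
  · refine S.asympEq_expectedTime_optTime hAC hInfo hempty hP hG hS tendsto_fst tendsto_snd
      (fun _ _ _ h => h) (D := fun p => Δ p.1 p.2) ?_ (fun p ω => min_le_left _ _) hC
    filter_upwards [eventually_mem_Ioo_of_tendsto_nhdsGT tendsto_fst,
      eventually_mem_Ioo_of_tendsto_nhdsGT tendsto_snd] with p h1 h2
    exact ⟨fun e he => ((h _ h1 _ h2).1 e he).1, (h _ h1 _ h2).2.2⟩
  · refine S.asympEq_expectedTime_optTime hAC hInfo hempty hP hG hS tendsto_fst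
      (tendsto_fst.comp tendsto_snd) (fun _ _ _ h => h.det)
      (D := fun p => S.jointDecision (τ p.1 p.2.1 p.2.2.1 p.2.2.2)) ?_
      (fun p ω => min_le_left _ _) hC
    have hcd : Tendsto (fun p : ℝ × ℝ × ℝ × ℝ => p.2.2)
        (𝓝[>] 0 ×ˢ 𝓝[>] 0 ×ˢ lγ ×ˢ lδ) (lγ ×ˢ lδ) := tendsto_snd.comp tendsto_snd
    -- The regimes of γ and δ serve only to place these levels eventually in (0, 1), where the
    -- procedure is known to be admissible.
    filter_upwards [eventually_mem_Ioo_of_tendsto_nhdsGT tendsto_fst,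
      eventually_mem_Ioo_of_tendsto_nhdsGT (tendsto_fst.comp tendsto_snd),
      (tendsto_fst.comp hcd).eventually hγ.eventually_mem_Ioo,
      (tendsto_snd.comp hcd).eventually hδ.eventually_mem_Ioo] with p h1 h2 h3 h4
    exact ⟨fun e he => ((h _ h1 _ h2 _ h3 _ h4).1 e he).2.2.1, (h _ h1 _ h2 _ h3 _ h4).2⟩
  -- Here γ is the false-alarm level, δ the missed-detection level, and the thresholds `A` also
  -- define T_0.
  · refine S.asympEq_expectedTime_optTime hAC hInfo hempty hP hG hS tendsto_fst tendsto_snd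
      (fun _ _ _ h => h.detClass hempty)
      (D := fun p => S.jointDecision ⟨A p.1 p.2, B p.1 p.2, A p.1 p.2, B p.1 p.2⟩) ?_
      (fun p ω => min_le_left _ _) hA
    filter_upwards [eventually_mem_Ioo_of_tendsto_nhdsGT tendsto_fst,
      eventually_mem_Ioo_of_tendsto_nhdsGT tendsto_snd] with p h1 h2
    exact ⟨fun e he => ((h _ h1 _ h2).1 e he).1, (h _ h1 _ h2).2⟩
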